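/- All graphs are finite and simple. A dominating set of a graph $G=(V,E)$ is a set $S\subseteq V$ such that every vertex of $G$ is in $S$ or adjacent to a vertex in $S$. The domination polynomial of $G$ is $D(G,x)=\sum_{i=1}^{|V|} d(G,i)\,x^i$, where $d(G,i)$ is the number of dominating sets of $G$ of size $i$. The graph $G$ is $\mathcal{D}$-unique if every graph $H$ with $D(H,x)=D(G,x)$ is isomorphic to $G$. The join $G_1\vee G_2$ is the disjoint union of $G_1$ and $G_2$ together with all edges between a vertex of $G_1$ and a vertex of $G_2$. Let $K_m$ be the complete graph of order $m$ and $C_n$ the cycle of order $n$, where $C_1=K_1$ and $C_2=K_2$. For all positive integers $m$ and $n$, the join $K_m\vee C_n$ is $\mathcal{D}$-unique. In particular, for every $n\ge 2$, the wheel $W_n=K_1\vee C_{n-1}$ of order $n$ is $\mathcal{D}$-unique. -/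

import Mathlib

namespace DomPoly

open Polynomial

/-- `S` is a dominating set of `G`: every vertex is in `S` or adjacent to a vertex in `S`. -/
def IsDominating {V : Type*} (G : SimpleGraph V) (S : Finset V) : Prop :=
  ∀ v : V, v ∈ S ∨ ∃ u ∈ S, G.Adj u v

open Classical in
/-- The family of dominating sets of `G` of cardinality `i`. -/
noncomputable def dominatingSets {V : Type*} [Fintype V] (G : SimpleGraph V) (i : ℕ) :
    Finset (Finset V) :=
  (Finset.powersetCard i Finset.univ).filter (IsDominating G)

/-- `d(G, i)`: the number of dominating sets of `G` of cardinality `i`. -/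
noncomputable def numDominating {V : Type*} [Fintype V] (G : SimpleGraph V) (i : ℕ) : ℕ :=
  (dominatingSets G i).card

/-- The domination polynomial `D(G, x) = ∑_{i=1}^{|V|} d(G, i) x^i`. -/
noncomputable def dominationPoly {V : Type*} [Fintype V] (G : SimpleGraph V) : ℤ[X] :=
  ∑ i ∈ Finset.Icc 1 (Fintype.card V), C (numDominating G i : ℤ) * X ^ i

/-- `𝒟`-equivalence of finite simple graphs: equality of domination polynomials. -/
def DEquivalent {V W : Type*} [Fintype V] [Fintype W] (G : SimpleGraph V) (H : SimpleGraph W) :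
    Prop :=
  dominationPoly G = dominationPoly H

/-- `G` is `𝒟`-unique: up to isomorphism `G` is the only finite simple graph (with vertex type in
an arbitrary universe `w`) that is `𝒟`-equivalent to `G`. -/
def DUnique.{w, u} {V : Type u} [Fintype V] (G : SimpleGraph V) : Prop :=
  ∀ (W : Type w) [Fintype W] (H : SimpleGraph W), DEquivalent H G → Nonempty (H ≃g G)

/-- The join of `G` and `H`: their disjoint union together with all edges between them. -/
def join {V W : Type*} (G : SimpleGraph V) (H : SimpleGraph W) : SimpleGraph (V ⊕ W) :=
  SimpleGraph.sum G H ⊔ completeBipartiteGraph V W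

/-- The wheel of order `n`, the join of `K_1` and `C_{n-1}`. It is meant for `n ≥ 2`; Mathlib's
`cycleGraph` has `C_1 = K_1` and `C_2 = K_2`. -/
def wheel (n : ℕ) : SimpleGraph (Fin 1 ⊕ Fin (n - 1)) :=
  join (SimpleGraph.completeGraph (Fin 1)) (SimpleGraph.cycleGraph (n - 1))

end DomPoly

universe w

/-!
Reading off coefficients, `𝒟`-equivalent graphs have equally many nondominating sets of each size.
In `K_m ∨ G` every vertex of `K_m` dominates on its own, so the nondominating sets of the join are
those of `G`. Sets of size one count the universal vertices, hence for `n ≥ 4` a graph that is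
`𝒟`-equivalent to `K_m ∨ C_n` is itself a join `K_m ∨ H` (`nonempty_iso_join_top`), where `H` has
the same counts as `C_n`; for `n ≤ 3` the join is a complete graph. It remains to show that `C_n`
is determined by its counts (`nonempty_iso_cycleGraph_of_numNonDominating_eq`).

A set is not dominating iff its complement contains a closed neighbourhood. The counts for
complements of size at most three thus force `H` to be `2`-regular
(`isTwoRegular_of_numNonDominating`), that is, a disjoint union of cycles. The reversed domination
polynomial `∑ y ^ (|V| - |S|)` over dominating sets `S` is multiplicative over disjoint unions, and
for `C_n` it is the trace of the `n`-th power of a transfer matrix, whose nonzero eigenvalues are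
the roots of `t ^ 3 = t ^ 2 + y * t + y ^ 2`. The substitution `y = z * (1 + z + z ^ 2)` makes one
root the polynomial `1 + z + z ^ 2`, and the other two roots contribute `z ^ n * u_n(z)` with
`u_n(0) ≠ 0`: the polynomial of `C_n` becomes `(1 + z + z ^ 2) ^ n + z ^ n * u_n(z)`
(`omitPoly_cycleGraph`). If `C_n` had the same polynomial as a union of shorter cycles of total
length `n`, of which `c ≥ 1` have the minimal length `l < n`, then comparing both sides modulo
`z ^ (l + 1)` would give `c * u_l(0) = 0`, a contradiction (`prod_cycleTerm_ne`).
-/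

namespace DomPoly

open Polynomial

/-! ### Closed walks and traces -/

section Trace

variable {R ι : Type*} [CommRing R] [Fintype ι] [DecidableEq ι]

/-- An entry of a matrix power is a sum over walks with prescribed end points, here encoded by the
tuple `w` of their interior vertices. -/
theorem sum_prod_cons_snoc (A : Matrix ι ι R) (n : ℕ) (a b : ι) :
    ∑ w : Fin n → ι, ∏ i : Fin (n + 1),
      A (Fin.cons (α := fun _ => ι) a w i) (Fin.snoc (α := fun _ => ι) w b i) =
      (A ^ (n + 1)) a b := by
  induction n generalizing a with
  | zero => simp [Fin.snoc]
  | succ n ih =>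
    rw [pow_succ', Matrix.mul_apply, ← (Fin.consEquiv (fun _ => ι)).sum_comp,
      Fintype.sum_prod_type]
    refine Finset.sum_congr rfl fun c _ => ?_
    rw [← ih c, Finset.mul_sum]
    refine Finset.sum_congr rfl fun w _ => ?_
    have h := Fin.cons_snoc_eq_snoc_cons c w b
    change ∏ i : Fin (n + 2), A (Fin.cons (α := fun _ => ι) a (Fin.cons (α := fun _ => ι) c w) i)
      (Fin.snoc (α := fun _ => ι) (Fin.cons (α := fun _ => ι) c w) b i) = _
    rw [← h, Fin.prod_univ_succ]
    simp only [Fin.cons_zero, Fin.cons_succ]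

/-- The trace of a matrix power is a sum over closed walks. -/
theorem sum_prod_cyclic (A : Matrix ι ι R) (n : ℕ) :
    ∑ w : Fin (n + 1) → ι, ∏ i, A (w i) (w (i + 1)) = (A ^ (n + 1)).trace := by
  rw [Matrix.trace, ← (Fin.consEquiv (fun _ => ι)).sum_comp, Fintype.sum_prod_type]
  refine Finset.sum_congr rfl fun a _ => ?_
  rw [Matrix.diag_apply, ← sum_prod_cons_snoc]
  refine Finset.sum_congr rfl fun w _ => ?_
  refine Finset.prod_congr rfl fun i _ => ?_
  rw [Fin.snoc_eq_cons_rotate]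
  change _ = A _ (Fin.cons (α := fun _ => ι) a w (finRotate (n + 1) i))
  rw [finRotate_apply]
  rfl

/-- The transfer matrix for a weight `g` on triples of cyclically consecutive letters: its states
are the pairs of consecutive letters. -/
def transferMatrix (g : Bool → Bool → Bool → R) : Matrix (Bool × Bool) (Bool × Bool) R :=
  fun s t => if s.2 = t.1 then g s.1 s.2 t.2 else 0

theorem sum_prod_triples (g : Bool → Bool → Bool → R) (n : ℕ) :
    ∑ f : Fin (n + 1) → Bool, ∏ i, g (f (i - 1)) (f i) (f (i + 1)) =
      (transferMatrix g ^ (n + 1)).trace := by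
  rw [← sum_prod_cyclic, ← (Equiv.arrowProdEquivProdArrow (Fin (n + 1))
    (fun _ => Bool) (fun _ => Bool)).symm.sum_comp, Fintype.sum_prod_type]
  refine Finset.sum_congr rfl fun f _ => ?_
  -- a sequence of states is a closed walk only if its second components are the shifted first ones
  rw [Finset.sum_eq_single (fun i => f (i + 1))]
  · rw [← Fintype.prod_equiv (Equiv.addRight (1 : Fin (n + 1))) _ _ fun _ => rfl]
    simp [transferMatrix, Equiv.arrowProdEquivProdArrow]
  · intro q _ hq
    obtain ⟨i, hi⟩ := Function.ne_iff.1 hq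
    exact Finset.prod_eq_zero (Finset.mem_univ i)
      (by simp [transferMatrix, Equiv.arrowProdEquivProdArrow, hi])
  · simp

end Trace

/-! ### The transfer matrix of a cycle -/

section Recurrence

variable {R : Type*} [CommRing R]

/-- The local weight at a vertex with two neighbours; `true` marks a vertex outside the dominating
set. -/
def pathWeight (y : R) (a b c : Bool) : R :=
  if a && b && c then 0 else if b then y else 1

/-- `z ^ n * cofactor z n` is the sum of the `n`-th powers of the two small eigenvalues of the
transfer matrix with parameter `y = z * (1 + z + z ^ 2)`. -/
def cofactor (z : R) : ℕ → R
  | 0 => 2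
  | 1 => -(1 + z)
  | n + 2 => -(1 + z) * cofactor z (n + 1) - (1 + z + z ^ 2) * cofactor z n

/-- The sum of the `n`-th powers of the nonzero eigenvalues of the transfer matrix with parameter
`y = z * (1 + z + z ^ 2)`. -/
def cycleTerm (z : R) (n : ℕ) : R :=
  (1 + z + z ^ 2) ^ n + z ^ n * cofactor z n

/-- The Cayley-Hamilton relation for the transfer matrix. -/
theorem transferMatrix_pow_four (y : R) :
    transferMatrix (pathWeight y) ^ 4 = transferMatrix (pathWeight y) ^ 3 +
      y • transferMatrix (pathWeight y) ^ 2 + y ^ 2 • transferMatrix (pathWeight y) := by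
  ext ⟨a, b⟩ ⟨c, d⟩
  cases a <;> cases b <;> cases c <;> cases d <;>
    simp [pow_succ, Matrix.mul_apply, Fintype.sum_prod_type, transferMatrix, pathWeight] <;> ring

theorem cycleTerm_add_three (z : R) (n : ℕ) :
    cycleTerm z (n + 3) = cycleTerm z (n + 2) + z * (1 + z + z ^ 2) * cycleTerm z (n + 1) +
      (z * (1 + z + z ^ 2)) ^ 2 * cycleTerm z n := by
  simp only [cycleTerm, cofactor]
  ring

theorem trace_transferMatrix_pow (z : R) (n : ℕ) :
    (transferMatrix (pathWeight (z * (1 + z + z ^ 2))) ^ (n + 1)).trace =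
      cycleTerm z (n + 1) := by
  induction n using Nat.strong_induction_on with
  | _ n ih =>
    match n, ih with
    | 0, _ =>
      simp [Matrix.trace, Fintype.sum_prod_type, transferMatrix, pathWeight, cycleTerm, cofactor]
      ring
    | 1, _ =>
      simp [Matrix.trace, pow_succ, Matrix.mul_apply, Fintype.sum_prod_type, transferMatrix,
        pathWeight, cycleTerm, cofactor]
      ring
    | 2, _ =>
      simp [Matrix.trace, pow_succ, Matrix.mul_apply, Fintype.sum_prod_type, transferMatrix,
        pathWeight, cycleTerm, cofactor]
      ring
    | n + 3, ih =>
      have h : ∀ A : Matrix (Bool × Bool) (Bool × Bool) R, A ^ (n + 3 + 1) = A ^ n * A ^ 4 :=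
        fun A => by rw [← pow_add]
      rw [cycleTerm_add_three, h, transferMatrix_pow_four, mul_add, mul_add, Matrix.mul_smul,
        Matrix.mul_smul, ← pow_add, ← pow_add, ← pow_succ, Matrix.trace_add, Matrix.trace_add,
        Matrix.trace_smul, Matrix.trace_smul, ih (n + 2) (by omega), ih (n + 1) (by omega),
        ih n (by omega)]
      simp only [smul_eq_mul]

/-! ### Products of cycle terms -/

/-- The constant terms are `2, -1, -1`, repeated with period three. -/
theorem cofactor_zero_ne_zero (n : ℕ) : cofactor (0 : ℤ) n ≠ 0 := by
  have h : ∀ n, cofactor (0 : ℤ) (n + 3) = cofactor (0 : ℤ) n := fun n => by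
    simp only [cofactor]; ring
  induction n using Nat.strong_induction_on with
  | _ n ih =>
    match n, ih with
    | 0, _ => simp [cofactor]
    | 1, _ => simp [cofactor]
    | 2, _ => simp [cofactor]
    | n + 3, ih => rw [h]; exact ih n (by omega)

/-- Multiplication by an element killed by `z` only sees the constant term of `cofactor z n`. -/
theorem mul_cofactor_of_mul_eq_zero {e z : R} (h : e * z = 0) (n : ℕ) :
    e * cofactor z n = e * (cofactor (0 : ℤ) n : ℤ) := by
  induction n using Nat.twoStepInduction with
  | zero => simp [cofactor]
  | one => simp only [cofactor]; push_cast; linear_combination -h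
  | more n h0 h1 =>
    simp only [cofactor]
    push_cast
    linear_combination -(1 + z) * h1 - (1 + z + z ^ 2) * h0 -
      ((cofactor (0 : ℤ) (n + 1) : ℤ) + (1 + z) * (cofactor (0 : ℤ) n : ℤ)) * h

theorem mul_pow_of_mul_eq_zero {e z : R} (h : e * z = 0) (n : ℕ) :
    e * (1 + z + z ^ 2) ^ n = e := by
  induction n with
  | zero => simp
  | succ n ih => rw [pow_succ, ← mul_assoc, ih]; linear_combination (1 + z) * h

/-- Modulo `z ^ (l + 1)`, a product of cycle terms with indices at least `l` only sees the sum of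
the indices and the number of indices equal to `l`. -/
theorem prod_cycleTerm_of_pow_eq_zero {z : R} {l : ℕ} (hl : 0 < l) (hz : z ^ (l + 1) = 0)
    (M : Multiset ℕ) (hM : ∀ m ∈ M, l ≤ m) :
    (M.map (cycleTerm z)).prod =
      (1 + z + z ^ 2) ^ M.sum + z ^ l * (M.count l * cofactor (0 : ℤ) l : ℤ) := by
  have hz1 : z ^ l * z = 0 := by rw [← pow_succ, hz]
  have hzz : z ^ l * z ^ l = 0 := by
    rw [← pow_add]; exact pow_eq_zero_of_le (by omega) hz
  induction M using Multiset.induction_on with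
  | empty => simp
  | cons m M ih =>
    rw [Multiset.map_cons, Multiset.prod_cons, Multiset.sum_cons, Multiset.count_cons,
      ih fun k hk => hM k (Multiset.mem_cons_of_mem hk)]
    have h1 := mul_pow_of_mul_eq_zero hz1 m
    have h2 := mul_pow_of_mul_eq_zero hz1 M.sum
    rcases (hM m (Multiset.mem_cons_self m M)).eq_or_lt with rfl | hlt
    · have h3 := mul_cofactor_of_mul_eq_zero hz1 l
      simp only [cycleTerm, if_true]
      rw [h3, pow_add]
      push_cast
      linear_combination (M.count l : R) * (cofactor (0 : ℤ) l : ℤ) * h1 +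
        (cofactor (0 : ℤ) l : ℤ) * h2 +
        (M.count l : R) * (cofactor (0 : ℤ) l : ℤ) * (cofactor (0 : ℤ) l : ℤ) * hzz
    · have h3 : z ^ m = 0 := pow_eq_zero_of_le hlt hz
      simp only [cycleTerm, h3, if_neg hlt.ne]
      rw [pow_add]
      push_cast
      linear_combination (M.count l : R) * (cofactor (0 : ℤ) l : ℤ) * h1

/-- A single cycle term is not a product of cycle terms with smaller indices adding up to its own
index: the smallest index can be read off. -/
theorem prod_cycleTerm_ne {n : ℕ} (hn : 0 < n) (M : Multiset ℕ) (hpos : ∀ m ∈ M, 0 < m)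
    (hlt : ∀ m ∈ M, m < n) (hsum : M.sum = n) :
    (M.map (cycleTerm (X : ℤ[X]))).prod ≠ cycleTerm X n := by
  intro h
  have hM : ∃ l, l ∈ M := Multiset.exists_mem_of_ne_zero (by rintro rfl; simp at hsum; omega)
  classical
  have hl := Nat.find_spec hM
  have hmin : ∀ m ∈ M, Nat.find hM ≤ m := fun m hm => Nat.find_min' hM hm
  generalize Nat.find hM = l at hl hmin
  -- compare both sides modulo `X ^ (l + 1)`, where `l` is the smallest index in `M`
  let q := Ideal.Quotient.mk (Ideal.span {(X : ℤ[X]) ^ (l + 1)})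
  have hmap : ∀ m, q (cycleTerm X m) = cycleTerm (q X) m := by
    have : ∀ m, q (cofactor X m) = cofactor (q X) m := fun m => by
      induction m using Nat.twoStepInduction with
      | zero => exact map_ofNat q 2
      | one => simp [cofactor]
      | more n h0 h1 => simp [cofactor, h0, h1]
    intro m
    simp [cycleTerm, this]
  have hz : (q X) ^ (l + 1) = 0 := by
    rw [← map_pow]
    exact Ideal.Quotient.eq_zero_iff_mem.2 (Ideal.mem_span_singleton_self _)
  have h' := congrArg q h
  rw [map_multiset_prod, Multiset.map_map, hmap] at h'
  simp only [Function.comp_def, hmap] at h'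
  have hn0 : (q X) ^ n = 0 := pow_eq_zero_of_le (hlt l hl) hz
  rw [prod_cycleTerm_of_pow_eq_zero (hpos l hl) hz M hmin, hsum, cycleTerm, hn0, zero_mul,
    add_zero, add_eq_left, ← map_pow, ← map_intCast q, ← map_mul, Ideal.Quotient.eq_zero_iff_mem,
    Ideal.mem_span_singleton, X_pow_dvd_iff] at h'
  have h0 := h' l (Nat.lt_succ_self l)
  rw [coeff_mul_intCast, coeff_X_pow_self, one_mul] at h0
  have hc : M.count l ≠ 0 := (Multiset.count_pos.2 hl).ne'
  simp [hc, cofactor_zero_ne_zero] at h0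

end Recurrence

/-! ### The domination polynomial as a sum of products of local weights -/

section OmitPoly

variable {R V W : Type*} [CommRing R]

open Classical in
/-- The local factor at `v` of the weight of a vertex subset, given by the indicator function `f` of
its complement: it vanishes iff `v` is not dominated, and is `y` at the omitted vertices. -/
noncomputable def omitWeight (G : SimpleGraph V) (y : R) (f : V → Bool) (v : V) : R :=
  if f v = true ∧ ∀ u, G.Adj u v → f u = true then 0 else if f v then y else 1

/-- The reversed domination polynomial: the sum of `y ^ (|V| - |S|)` over all dominating sets `S`,
with `S` encoded by the indicator function of its complement. -/
noncomputable def omitPoly [Fintype V] [DecidableEq V] (G : SimpleGraph V) (y : R) : R :=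
  ∑ f : V → Bool, ∏ v, omitWeight G y f v

theorem omitWeight_congr {G : SimpleGraph V} {H : SimpleGraph W} {f : V → Bool} {g : W → Bool}
    {v : V} {w : W} (y : R) (hfg : f v = g w)
    (h : (∀ u, G.Adj u v → f u = true) ↔ ∀ u, H.Adj u w → g u = true) :
    omitWeight G y f v = omitWeight H y g w := by
  classical
  simp only [omitWeight, hfg]
  congr 1
  rw [h]

variable [Fintype V] [DecidableEq V] [Fintype W] [DecidableEq W]

theorem omitPoly_congr {G : SimpleGraph V} {H : SimpleGraph W} (e : G ≃g H) (y : R) :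
    omitPoly G y = omitPoly H y := by
  refine Fintype.sum_equiv (Equiv.arrowCongr e.toEquiv (Equiv.refl Bool)) _ _ fun f => ?_
  refine Fintype.prod_equiv e.toEquiv _ _ fun v => ?_
  have h : (∀ u, H.Adj u (e v) → f (e.symm u) = true) ↔ ∀ u, G.Adj u v → f u = true := by
    constructor
    · intro h u hu
      simpa using h (e u) (e.map_adj_iff.2 hu)
    · intro h u hu
      exact h _ (by rw [← e.map_adj_iff]; simpa using hu)
  exact omitWeight_congr (w := e v) (g := fun u => f (e.symm u)) y (by simp) h.symm

theorem omitPoly_sum (G : SimpleGraph V) (H : SimpleGraph W) (y : R) :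
    omitPoly (G.sum H) y = omitPoly G y * omitPoly H y := by
  rw [omitPoly, ← (Equiv.sumArrowEquivProdArrow V W Bool).symm.sum_comp, Fintype.sum_prod_type,
    omitPoly, omitPoly, Finset.sum_mul_sum]
  refine Finset.sum_congr rfl fun f _ => Finset.sum_congr rfl fun g _ => ?_
  rw [Fintype.prod_sum_type]
  congr 1
  · refine Finset.prod_congr rfl fun v _ => ?_
    have h : (∀ u, (G.sum H).Adj u (Sum.inl v) →
        (Equiv.sumArrowEquivProdArrow V W Bool).symm (f, g) u = true) ↔
        ∀ u, G.Adj u v → f u = true := by simp [Sum.forall]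
    exact omitWeight_congr y rfl h
  · refine Finset.prod_congr rfl fun v _ => ?_
    have h : (∀ u, (G.sum H).Adj u (Sum.inr v) →
        (Equiv.sumArrowEquivProdArrow V W Bool).symm (f, g) u = true) ↔
        ∀ u, H.Adj u v → g u = true := by simp [Sum.forall]
    exact omitWeight_congr y rfl h

theorem omitPoly_eq_sum_numDominating (G : SimpleGraph V) (y : R) :
    omitPoly G y = ∑ i ∈ Finset.range (Fintype.card V + 1),
      (numDominating G i : R) * y ^ (Fintype.card V - i) := by
  classical
  have h1 : omitPoly G y =
      ∑ S : Finset V, if IsDominating G S then y ^ (Fintype.card V - S.card) else 0 := by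
    refine Finset.sum_bij' (fun f _ => Finset.univ.filter fun v => f v = false)
      (fun S _ v => decide (v ∉ S)) (by simp) (by simp) ?_ ?_ ?_
    · intro f _; ext v; simp
    · intro S _; ext v; simp
    · intro f _
      by_cases hd : IsDominating G (Finset.univ.filter fun v => f v = false)
      · rw [if_pos hd]
        have hw : ∀ v, omitWeight G y f v = if f v then y else 1 := by
          intro v
          refine if_neg ?_
          rintro ⟨hv, hu⟩
          rcases hd v with h | ⟨u, h, hadj⟩
          · simp [hv] at h
          · simp [hu u hadj] at h
        rw [Finset.prod_congr rfl fun v _ => hw v, Finset.prod_ite, Finset.prod_const,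
          Finset.prod_const_one, mul_one, ← Finset.card_compl]
        congr 2
        ext v; simp
      · rw [if_neg hd]
        simp only [IsDominating, not_forall, not_or, not_exists] at hd
        obtain ⟨v, hv, hu⟩ := hd
        refine Finset.prod_eq_zero (Finset.mem_univ v) (if_pos ⟨by simpa using hv, ?_⟩)
        intro u hadj
        by_contra hne
        exact hu u ⟨by simpa using hne, hadj⟩
  rw [h1, ← Finset.sum_fiberwise_of_maps_to (g := Finset.card)
    (t := Finset.range (Fintype.card V + 1))
    (fun S _ => Finset.mem_range.2 (Nat.lt_succ_of_le (Finset.card_le_univ S)))]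
  refine Finset.sum_congr rfl fun i _ => ?_
  rw [Finset.sum_ite, Finset.sum_const_zero, add_zero, Finset.sum_congr rfl
    (g := fun _ => y ^ (Fintype.card V - i)) ?_, Finset.sum_const, nsmul_eq_mul]
  · congr 3
    ext S
    simp [dominatingSets, Finset.mem_powersetCard]
  · intro S hS
    rw [(Finset.mem_filter.1 (Finset.mem_filter.1 hS).1).2]

theorem cycleGraph_adj_iff {n : ℕ} {u v : Fin (n + 1)} :
    (SimpleGraph.cycleGraph (n + 1)).Adj u v ↔ u ≠ v ∧ (u = v - 1 ∨ u = v + 1) := by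
  rw [SimpleGraph.cycleGraph_eq_circulantGraph, SimpleGraph.circulantGraph,
    SimpleGraph.fromRel_adj]
  simp only [Set.mem_singleton_iff]
  refine and_congr_right fun _ => ?_
  constructor
  · rintro (h | h)
    · right; rw [← h]; abel
    · left; rw [← h]; abel
  · rintro (h | h)
    · right; rw [h]; abel
    · left; rw [h]; abel

theorem omitPoly_cycleGraph (z : R) {n : ℕ} (hn : 0 < n) :
    omitPoly (SimpleGraph.cycleGraph n) (z * (1 + z + z ^ 2)) = cycleTerm z n := by
  obtain ⟨n, rfl⟩ := Nat.exists_eq_succ_of_ne_zero hn.ne'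
  rw [Nat.succ_eq_add_one, ← trace_transferMatrix_pow, ← sum_prod_triples, omitPoly]
  refine Finset.sum_congr rfl fun f _ => Finset.prod_congr rfl fun i _ => ?_
  have h : (f i = true ∧ ∀ u, (SimpleGraph.cycleGraph (n + 1)).Adj u i → f u = true) ↔
      (f (i - 1) && f i && f (i + 1)) = true := by
    simp only [cycleGraph_adj_iff, Bool.and_eq_true]
    constructor
    · rintro ⟨hi, hu⟩
      have hu' : ∀ u, (u = i - 1 ∨ u = i + 1) → f u = true := fun u h => by
        by_cases hui : u = i
        · rw [hui, hi]
        · exact hu u ⟨hui, h⟩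
      exact ⟨⟨hu' _ (Or.inl rfl), hi⟩, hu' _ (Or.inr rfl)⟩
    · rintro ⟨⟨h1, h2⟩, h3⟩
      refine ⟨h2, ?_⟩
      rintro u ⟨_, rfl | rfl⟩ <;> assumption
  rw [omitWeight, pathWeight]
  by_cases hc : (f (i - 1) && f i && f (i + 1)) = true
  · rw [if_pos hc, if_pos (h.2 hc)]
  · rw [if_neg hc, if_neg (mt h.1 hc)]

end OmitPoly

/-! ### The structure of `2`-regular graphs -/

section TwoRegular

variable {V : Type*} {G : SimpleGraph V}

/-- Every vertex has exactly two neighbours. -/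
def IsTwoRegular (G : SimpleGraph V) : Prop :=
  ∀ v, (G.neighborSet v).ncard = 2

theorem IsTwoRegular.adj_iff (hG : IsTwoRegular G) {v a b : V} (ha : G.Adj v a) (hb : G.Adj v b)
    (hab : a ≠ b) (w : V) : G.Adj v w ↔ w = a ∨ w = b := by
  have h : ({a, b} : Set V) = G.neighborSet v := by
    refine Set.eq_of_subset_of_ncard_le ?_ ?_ (Set.finite_of_ncard_pos (by rw [hG v]; norm_num))
    · rintro x (rfl | rfl) <;> assumption
    · rw [hG v, Set.ncard_pair hab]
  rw [← SimpleGraph.mem_neighborSet, ← h, Set.mem_insert_iff, Set.mem_singleton_iff]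

theorem IsTwoRegular.exists_adj_ne (hG : IsTwoRegular G) (u v : V) : ∃ w, G.Adj v w ∧ w ≠ u := by
  obtain ⟨a, b, hab, h⟩ := Set.ncard_eq_two.1 (hG v)
  have ha : G.Adj v a := by rw [← SimpleGraph.mem_neighborSet, h]; simp
  have hb : G.Adj v b := by rw [← SimpleGraph.mem_neighborSet, h]; simp
  by_cases hau : a = u
  · exact ⟨b, hb, fun hbu => hab (hau.trans hbu.symm)⟩
  · exact ⟨a, ha, hau⟩

/-- A walk that never turns back in a finite `2`-regular graph closes up for the first time at its
starting vertex, and so traces out a cycle. -/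
theorem IsTwoRegular.exists_cycle [Finite V] [Nonempty V] (hG : IsTwoRegular G) :
    ∃ (k : ℕ) (s : Fin (k + 3) → V), Function.Injective s ∧ ∀ i, G.Adj (s i) (s (i + 1)) := by
  classical
  obtain ⟨v₀⟩ := ‹Nonempty V›
  choose next hadj hne using hG.exists_adj_ne
  -- the state of the walk consists of its current and its next vertex
  let d : ℕ → V × V := fun k => (fun e : V × V => (e.2, next e.1 e.2))^[k] (v₀, next v₀ v₀)
  let s : ℕ → V := fun k => (d k).1
  have hd : ∀ k, d (k + 1) = ((d k).2, next (d k).1 (d k).2) := fun k =>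
    Function.iterate_succ_apply' _ _ _
  have hs1 : ∀ k, s (k + 1) = (d k).2 := fun k => by simp only [s, hd]
  have hs2 : ∀ k, s (k + 2) = next (s k) (s (k + 1)) := fun k => by
    rw [hs1 (k + 1), hd, hs1]
  have hstep : ∀ k, G.Adj (s k) (s (k + 1)) := by
    intro k
    cases k with
    | zero => exact hadj v₀ v₀
    | succ k => rw [hs2]; exact hadj _ _
  have hback : ∀ k, s (k + 2) ≠ s k := fun k => by rw [hs2]; exact hne _ _
  have hrep : ∃ j, ∃ i < j, s i = s j := by
    obtain ⟨i, j, hij, h⟩ := Finite.exists_ne_map_eq_of_infinite s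
    rcases lt_or_gt_of_ne hij with hlt | hlt
    · exact ⟨j, i, hlt, h⟩
    · exact ⟨i, j, hlt, h.symm⟩
  obtain ⟨i, hi, hij⟩ := Nat.find_spec hrep
  have hmin : ∀ a b, a < b → b < Nat.find hrep → s a ≠ s b := fun a b hab hb h =>
    Nat.find_min hrep hb ⟨a, hab, h⟩
  generalize Nat.find hrep = p at hi hij hmin
  -- a first repetition at a later vertex would give that vertex three neighbours
  have hi0 : i = 0 := by
    by_contra hi0
    obtain ⟨i, rfl⟩ := Nat.exists_eq_succ_of_ne_zero hi0
    obtain ⟨p, rfl⟩ := Nat.exists_eq_succ_of_ne_zero (by omega : p ≠ 0)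
    have hp : G.Adj (s (i + 1)) (s p) := by
      rw [hij]; exact (hstep p).symm
    rcases (hG.adj_iff (hstep i).symm (hstep (i + 1)) (hback i).symm _).1 hp with h | h
    · exact hmin i p (by omega) (by omega) h.symm
    · rcases lt_trichotomy p (i + 2) with hlt | rfl | hlt
      · have : p = i + 1 := by omega
        subst this
        exact (hstep (i + 1)).ne h
      · exact hback (i + 1) hij.symm
      · exact hmin (i + 2) p hlt (by omega) h.symm
  subst hi0
  have hp3 : 3 ≤ p := by
    by_contra hp
    have : p = 1 ∨ p = 2 := by omega
    rcases this with rfl | rfl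
    · exact (hstep 0).ne hij
    · exact hback 0 hij.symm
  obtain ⟨k, rfl⟩ := Nat.exists_eq_add_of_le' hp3
  refine ⟨k, fun i => s i, fun a b hab => ?_, fun i => ?_⟩
  · rcases lt_trichotomy a b with h | h | h
    · exact absurd hab (hmin _ _ h b.2)
    · exact h
    · exact absurd hab.symm (hmin _ _ h a.2)
  · by_cases hil : i = Fin.last (k + 2)
    · subst hil
      have := hstep (k + 2)
      rw [← hij] at this
      simpa using this
    · have : ((i + 1 : Fin (k + 3)) : ℕ) = i + 1 :=
        Fin.val_add_one_of_lt (Fin.lt_last_iff_ne_last.2 hil)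
      simp only [this]
      exact hstep i

theorem IsTwoRegular.adj_cycle_iff (hG : IsTwoRegular G) {k : ℕ} {s : Fin (k + 3) → V}
    (hs : Function.Injective s) (hadj : ∀ i, G.Adj (s i) (s (i + 1))) (i : Fin (k + 3)) (w : V) :
    G.Adj (s i) w ↔ w = s (i - 1) ∨ w = s (i + 1) := by
  refine hG.adj_iff ?_ (hadj i) (fun h => ?_) w
  · simpa using (hadj (i - 1)).symm
  · have h2 : (1 : Fin (k + 3)) + 1 = 0 := by
      have := hs h
      rw [sub_eq_iff_eq_add, add_assoc, left_eq_add] at this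
      exact this
    have h3 := congrArg Fin.val h2
    rw [Fin.val_add] at h3
    have h4 : 2 % (k + 3) = 0 := by simpa using h3
    rw [Nat.mod_eq_of_lt (by omega)] at h4
    omega

/-- A cycle in a `2`-regular graph is an induced cycle graph. -/
theorem IsTwoRegular.nonempty_iso_induce_range (hG : IsTwoRegular G) {k : ℕ} {s : Fin (k + 3) → V}
    (hs : Function.Injective s) (hadj : ∀ i, G.Adj (s i) (s (i + 1))) :
    Nonempty (G.induce (Set.range s) ≃g SimpleGraph.cycleGraph (k + 3)) := by
  refine ⟨RelIso.symm ⟨Equiv.ofInjective s hs, ?_⟩⟩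
  intro i j
  simp only [SimpleGraph.comap_adj, Function.Embedding.subtype_apply, Equiv.ofInjective_apply]
  rw [G.adj_comm, hG.adj_cycle_iff hs hadj, hs.eq_iff, hs.eq_iff, cycleGraph_adj_iff, iff_and_self]
  rintro h rfl
  have h3 : G.Adj (s i) (s i) := (hG.adj_cycle_iff hs hadj i _).2 (by simpa [hs.eq_iff] using h)
  exact G.loopless.irrefl _ h3

/-- A graph is the disjoint union of the subgraphs induced on a set closed under adjacency and on
its complement. -/
theorem nonempty_iso_sum_induce (S : Set V) (hS : ∀ v ∈ S, ∀ w, G.Adj v w → w ∈ S) :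
    Nonempty ((G.induce S).sum (G.induce Sᶜ) ≃g G) := by
  classical
  refine ⟨⟨Equiv.Set.sumCompl S, ?_⟩⟩
  rintro (⟨a, ha⟩ | ⟨a, ha⟩) (⟨b, hb⟩ | ⟨b, hb⟩)
  · simp
  · simpa using fun h => hb (hS a ha b h)
  · simpa using fun h => ha (hS b hb a h.symm)
  · simp

theorem IsTwoRegular.induce (hG : IsTwoRegular G) {S : Set V}
    (hS : ∀ v ∈ S, ∀ w, G.Adj v w → w ∈ S) : IsTwoRegular (G.induce S) := by
  rintro ⟨v, hv⟩
  rw [← hG v, ← Set.ncard_image_of_injective _ Subtype.val_injective]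
  congr 1
  ext w
  constructor
  · rintro ⟨x, hx, rfl⟩
    exact hx
  · intro hw
    exact ⟨⟨w, hS v hv w hw⟩, hw, rfl⟩

/-- A nonempty `2`-regular graph is a cycle, or its reversed domination polynomial is a product of
those of shorter cycles. -/
theorem IsTwoRegular.iso_cycleGraph_or_omitPoly_eq_prod {R : Type*} [CommRing R] (z : R) (n : ℕ)
    {V : Type*} [Fintype V] [DecidableEq V] [Nonempty V] {G : SimpleGraph V} (hG : IsTwoRegular G)
    (hn : Fintype.card V = n) :
    Nonempty (G ≃g SimpleGraph.cycleGraph n) ∨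
      ∃ M : Multiset ℕ, (∀ m ∈ M, 0 < m) ∧ (∀ m ∈ M, m < n) ∧ M.sum = n ∧
        omitPoly G (z * (1 + z + z ^ 2)) = (M.map (cycleTerm z)).prod := by
  induction n using Nat.strong_induction_on generalizing V with
  | _ n ih =>
    classical
    obtain ⟨k, s, hs, hadj⟩ := hG.exists_cycle
    obtain ⟨e⟩ := hG.nonempty_iso_induce_range hs hadj
    have hclosed : ∀ v ∈ Set.range s, ∀ w, G.Adj v w → w ∈ Set.range s := by
      rintro _ ⟨i, rfl⟩ w hw
      rcases (hG.adj_cycle_iff hs hadj i w).1 hw with rfl | rfl <;> exact ⟨_, rfl⟩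
    have hclosed' : ∀ v ∈ (Set.range s)ᶜ, ∀ w, G.Adj v w → w ∈ (Set.range s)ᶜ :=
      fun v hv w hw hwS => hv (hclosed w hwS v hw.symm)
    obtain ⟨e'⟩ := nonempty_iso_sum_induce _ hclosed
    have hc1 : Fintype.card (Set.range s) = k + 3 := by
      rw [Set.card_range_of_injective hs, Fintype.card_fin]
    have hc : k + 3 + Fintype.card ((Set.range s)ᶜ : Set V) = n := by
      have h := Fintype.card_congr e'.toEquiv
      rwa [Fintype.card_sum, hc1, hn] at h
    rcases isEmpty_or_nonempty ((Set.range s)ᶜ : Set V) with hE | hE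
    · left
      rw [Fintype.card_eq_zero, add_zero] at hc
      subst hc
      have hu : Set.range s = Set.univ := by
        rwa [← Set.compl_empty_iff, ← Set.isEmpty_coe_sort]
      refine ⟨RelIso.trans (RelIso.symm ?_) e⟩
      rw [hu]
      exact SimpleGraph.induceUnivIso G
    · right
      have hpos := Fintype.card_pos (α := ((Set.range s)ᶜ : Set V))
      have hprod : omitPoly G (z * (1 + z + z ^ 2)) = cycleTerm z (k + 3) *
          omitPoly (G.induce (Set.range s)ᶜ) (z * (1 + z + z ^ 2)) := by
        rw [← omitPoly_congr e', omitPoly_sum, omitPoly_congr e, omitPoly_cycleGraph z (by omega)]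
      rcases ih _ (by omega) (hG.induce hclosed') rfl with ⟨⟨f⟩⟩ | ⟨M, h0, h1, h2, h3⟩
      · refine ⟨{k + 3, Fintype.card ((Set.range s)ᶜ : Set V)}, ?_, ?_, ?_, ?_⟩
        · simpa using hpos
        · simp only [Multiset.insert_eq_cons, Multiset.mem_cons, Multiset.mem_singleton]
          omega
        · simpa using hc
        · rw [hprod, omitPoly_congr f, omitPoly_cycleGraph z hpos]
          simp
      · refine ⟨(k + 3) ::ₘ M, ?_, ?_, ?_, ?_⟩
        · simpa using h0
        · simp only [Multiset.mem_cons]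
          rintro m (rfl | hm)
          · omega
          · have := h1 m hm; omega
        · rw [Multiset.sum_cons, h2, hc]
        · rw [hprod, h3, Multiset.map_cons, Multiset.prod_cons]

end TwoRegular

/-! ### Counting nondominating sets -/

section Counting

variable {V W : Type*} [Fintype V] [Fintype W]

open Classical in
/-- The number of vertex subsets of cardinality `i` that are not dominating. -/
noncomputable def numNonDominating (G : SimpleGraph V) (i : ℕ) : ℕ :=
  ((Finset.powersetCard i Finset.univ).filter fun S => ¬ IsDominating G S).card

theorem numDominating_add_numNonDominating (G : SimpleGraph V) (i : ℕ) :
    numDominating G i + numNonDominating G i = (Fintype.card V).choose i := by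
  classical
  rw [numDominating, dominatingSets, numNonDominating, Finset.card_filter_add_card_filter_not,
    Finset.card_powersetCard, Finset.card_univ]

theorem numDominating_zero [Nonempty V] (G : SimpleGraph V) : numDominating G 0 = 0 := by
  classical
  rw [numDominating, dominatingSets, Finset.card_eq_zero, Finset.filter_eq_empty_iff]
  intro S hS hd
  rw [Finset.powersetCard_zero, Finset.mem_singleton] at hS
  subst hS
  rcases hd (Classical.arbitrary V) with h | ⟨u, h, _⟩ <;> simp at h

theorem numDominating_card (G : SimpleGraph V) : numDominating G (Fintype.card V) = 1 := by
  classical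
  rw [numDominating, dominatingSets, ← Finset.card_univ, Finset.powersetCard_self,
    Finset.filter_singleton, if_pos (show IsDominating G Finset.univ from
      fun v => Or.inl (Finset.mem_univ v)), Finset.card_singleton]

theorem numDominating_of_card_lt (G : SimpleGraph V) {i : ℕ} (hi : Fintype.card V < i) :
    numDominating G i = 0 := by
  classical
  rw [numDominating, dominatingSets, Finset.powersetCard_eq_empty.2 (by rwa [Finset.card_univ]),
    Finset.filter_empty, Finset.card_empty]

theorem coeff_dominationPoly (G : SimpleGraph V) {i : ℕ} (hi : 0 < i) :
    (dominationPoly G).coeff i = numDominating G i := by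
  simp only [dominationPoly, finsetSum_coeff, coeff_C_mul, coeff_X_pow, mul_ite, mul_one, mul_zero,
    Finset.sum_ite_eq, Finset.mem_Icc]
  split_ifs with h
  · rfl
  · rw [numDominating_of_card_lt G (by omega), Nat.cast_zero]

theorem DEquivalent.numDominating_eq {G : SimpleGraph V} {H : SimpleGraph W}
    (h : DEquivalent G H) {i : ℕ} (hi : 0 < i) : numDominating G i = numDominating H i := by
  have h' := congrArg (fun p => p.coeff i) h
  simp only [coeff_dominationPoly _ hi] at h'
  exact_mod_cast h'

theorem DEquivalent.card_eq [Nonempty V] {G : SimpleGraph W} {H : SimpleGraph V}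
    (h : DEquivalent G H) : Fintype.card W = Fintype.card V := by
  rcases lt_trichotomy (Fintype.card W) (Fintype.card V) with hlt | heq | hlt
  · have h1 := h.numDominating_eq (Fintype.card_pos (α := V))
    rw [numDominating_of_card_lt G hlt, numDominating_card] at h1
    omega
  · exact heq
  · have h1 := h.numDominating_eq (Nat.zero_lt_of_lt hlt)
    rw [numDominating_of_card_lt H hlt, numDominating_card] at h1
    omega

theorem numNonDominating_eq_of_numDominating_eq {G : SimpleGraph V} {H : SimpleGraph W}
    (hc : Fintype.card V = Fintype.card W) {i : ℕ} (h : numDominating G i = numDominating H i) :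
    numNonDominating G i = numNonDominating H i := by
  have h1 := numDominating_add_numNonDominating G i
  have h2 := numDominating_add_numNonDominating H i
  rw [hc] at h1
  omega

theorem DEquivalent.numNonDominating_eq [Nonempty V] {G : SimpleGraph W} {H : SimpleGraph V}
    (h : DEquivalent G H) (i : ℕ) : numNonDominating G i = numNonDominating H i := by
  refine numNonDominating_eq_of_numDominating_eq h.card_eq ?_
  rcases Nat.eq_zero_or_pos i with rfl | hi
  · have : Nonempty W := Fintype.card_pos_iff.1 (h.card_eq ▸ Fintype.card_pos)
    rw [numDominating_zero, numDominating_zero]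
  · exact h.numDominating_eq hi

theorem isDominating_map_iff {V W : Type*} {G : SimpleGraph V} {H : SimpleGraph W} (e : G ≃g H)
    (S : Finset V) : IsDominating H (S.map e.toEquiv.toEmbedding) ↔ IsDominating G S := by
  have hmem : ∀ v, e v ∈ S.map e.toEquiv.toEmbedding ↔ v ∈ S := fun v => Finset.mem_map' _
  rw [IsDominating, IsDominating, e.surjective.forall]
  refine forall_congr' fun v => ?_
  rw [hmem, e.surjective.exists]
  simp only [hmem, e.map_adj_iff]

theorem numNonDominating_congr {G : SimpleGraph V} {H : SimpleGraph W} (e : G ≃g H) (i : ℕ) :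
    numNonDominating G i = numNonDominating H i := by
  classical
  refine Finset.card_nbij' (fun S => S.map e.toEquiv.toEmbedding)
    (fun S => S.map e.symm.toEquiv.toEmbedding) ?_ ?_ ?_ ?_
  · intro S hS
    simp only [Finset.coe_filter, Set.mem_ofPred_eq, Finset.mem_powersetCard_univ] at hS ⊢
    rwa [Finset.card_map, isDominating_map_iff]
  · intro S hS
    simp only [Finset.coe_filter, Set.mem_ofPred_eq, Finset.mem_powersetCard_univ] at hS ⊢
    rwa [Finset.card_map, isDominating_map_iff]
  · intro S _
    ext v
    simp only [Finset.mem_map_equiv]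
    exact iff_of_eq (congrArg (· ∈ S) (e.symm_apply_apply v))
  · intro S _
    ext v
    simp only [Finset.mem_map_equiv]
    exact iff_of_eq (congrArg (· ∈ S) (e.apply_symm_apply v))

/-- Each vertex of the complete factor of a join dominates on its own, so that the nondominating
sets of the join are those of the other factor. -/
theorem numNonDominating_join_top [Nonempty W] (H : SimpleGraph W) (i : ℕ) :
    numNonDominating (join (⊤ : SimpleGraph V) H) i = numNonDominating H i := by
  classical
  symm
  refine Finset.card_nbij (fun S => S.map Function.Embedding.inr) ?_ ?_ ?_
  · intro S hS
    simp only [Finset.coe_filter, Set.mem_ofPred_eq, Finset.mem_powersetCard_univ] at hS ⊢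
    refine ⟨by rw [Finset.card_map, hS.1], fun hd => hS.2 fun w => ?_⟩
    simpa [join] using hd (Sum.inr w)
  · exact (Finset.map_injective _).injOn
  · intro S hS
    simp only [Finset.coe_filter, Set.mem_ofPred_eq, Finset.mem_powersetCard_univ] at hS
    have hl : ∀ v, Sum.inl v ∉ S := by
      intro v hv
      refine hS.2 ?_
      rintro (u | w)
      · by_cases huv : v = u
        · exact Or.inl (huv ▸ hv)
        · exact Or.inr ⟨_, hv, by simp [join, huv]⟩
      · exact Or.inr ⟨_, hv, by simp [join]⟩
    have hS' : (Finset.univ.filter fun w => Sum.inr w ∈ S).map Function.Embedding.inr = S := by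
      ext (v | w)
      · simp [hl]
      · simp
    refine ⟨Finset.univ.filter fun w => Sum.inr w ∈ S, ?_, hS'⟩
    simp only [Finset.coe_filter, Set.mem_ofPred_eq, Finset.mem_powersetCard_univ]
    refine ⟨by rw [← hS.1, ← hS', Finset.card_map, hS'], fun hd => hS.2 ?_⟩
    have hd' : ∀ w, Sum.inr w ∈ S ∨ ∃ u, Sum.inr u ∈ S ∧ H.Adj u w := fun w => by
      simpa using hd w
    rintro (v | w)
    · obtain ⟨w, hw⟩ : ∃ w, Sum.inr w ∈ S := by
        rcases hd' (Classical.arbitrary W) with h | ⟨u, h, _⟩ <;> exact ⟨_, h⟩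
      exact Or.inr ⟨_, hw, by simp [join]⟩
    · rcases hd' w with h | ⟨u, h, hadj⟩
      · exact Or.inl h
      · exact Or.inr ⟨_, h, by simpa [join] using hadj⟩

open Classical in
theorem numNonDominating_one (G : SimpleGraph V) :
    numNonDominating G 1 = (Finset.univ.filter fun v => ¬ IsDominating G {v}).card := by
  rw [numNonDominating, Finset.powersetCard_one, Finset.filter_map, Finset.card_map]
  rfl

theorem isDominating_singleton_iff {V : Type*} {G : SimpleGraph V} {v : V} :
    IsDominating G {v} ↔ ∀ w, w ≠ v → G.Adj v w := by
  simp only [IsDominating, Finset.mem_singleton, exists_eq_left, or_iff_not_imp_left, ne_eq]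

theorem numNonDominating_one_eq_zero_iff (G : SimpleGraph V) :
    numNonDominating G 1 = 0 ↔ G = ⊤ := by
  classical
  rw [numNonDominating_one, Finset.card_eq_zero, Finset.filter_eq_empty_iff]
  simp only [Finset.mem_univ, true_imp_iff, not_not, isDominating_singleton_iff]
  constructor
  · intro h
    ext v w
    rw [SimpleGraph.top_adj]
    exact ⟨fun hvw => hvw.ne, fun hvw => h w hvw.symm⟩
  · rintro rfl v w h
    exact h.symm

/-! ### Closed neighbourhoods and nondominating sets with small complement -/

open Classical in
/-- The closed neighbourhood of a vertex. -/
noncomputable def closedNeighborFinset (G : SimpleGraph V) (v : V) : Finset V :=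
  Finset.univ.filter fun u => u = v ∨ G.Adj v u

open Classical in
/-- A set is not dominating iff its complement contains a closed neighbourhood. -/
theorem numNonDominating_card_sub (G : SimpleGraph V) {j : ℕ} (hj : j ≤ Fintype.card V) :
    numNonDominating G (Fintype.card V - j) = ((Finset.powersetCard j Finset.univ).filter fun T =>
      ∃ v, closedNeighborFinset G v ⊆ T).card := by
  have key : ∀ S : Finset V, ¬ IsDominating G S ↔ ∃ v, closedNeighborFinset G v ⊆ Sᶜ := by
    intro S
    simp only [IsDominating, not_forall, not_or, not_exists, not_and]
    refine exists_congr fun v => ⟨fun h u hu => ?_, fun h => ⟨?_, fun u hu hadj => ?_⟩⟩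
    · rw [Finset.mem_compl]
      rintro hS
      rcases (Finset.mem_filter.1 hu).2 with rfl | hadj
      · exact h.1 hS
      · exact h.2 u hS hadj.symm
    · exact Finset.mem_compl.1 (h (by simp [closedNeighborFinset]))
    · exact Finset.mem_compl.1 (h (by simp [closedNeighborFinset, hadj.symm])) hu
  refine Finset.card_nbij' compl compl ?_ ?_ (fun _ _ => compl_compl _) (fun _ _ => compl_compl _)
  · intro S hS
    simp only [Finset.coe_filter, Set.mem_ofPred_eq, Finset.mem_powersetCard_univ] at hS ⊢
    exact ⟨by rw [Finset.card_compl, hS.1]; omega, (key S).1 hS.2⟩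
  · intro S hS
    simp only [Finset.coe_filter, Set.mem_ofPred_eq, Finset.mem_powersetCard_univ] at hS ⊢
    exact ⟨by rw [Finset.card_compl, hS.1], (key _).2 (by rw [compl_compl]; exact hS.2)⟩

theorem numNonDominating_card_sub_eq_zero {G : SimpleGraph V} {j : ℕ} (hj : j ≤ Fintype.card V)
    (h : ∀ v, j < (closedNeighborFinset G v).card) :
    numNonDominating G (Fintype.card V - j) = 0 := by
  classical
  rw [numNonDominating_card_sub G hj, Finset.card_eq_zero, Finset.filter_eq_empty_iff]
  rintro T hT ⟨v, hv⟩
  have := Finset.card_le_card hv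
  rw [Finset.mem_powersetCard_univ.1 hT] at this
  exact absurd (h v) (by omega)

theorem card_le_numNonDominating_card_sub {G : SimpleGraph V} {j : ℕ} (hj : j ≤ Fintype.card V)
    (h : ∀ v, (closedNeighborFinset G v).card = j)
    (hinj : Function.Injective (closedNeighborFinset G)) :
    Fintype.card V ≤ numNonDominating G (Fintype.card V - j) := by
  classical
  rw [numNonDominating_card_sub G hj, ← Finset.card_univ, ← Finset.card_image_of_injective _ hinj]
  refine Finset.card_le_card fun T hT => ?_
  obtain ⟨v, _, rfl⟩ := Finset.mem_image.1 hT
  exact Finset.mem_filter.2 ⟨Finset.mem_powersetCard_univ.2 (h v), v, subset_rfl⟩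

theorem card_closedNeighborFinset (G : SimpleGraph V) (v : V) :
    (closedNeighborFinset G v).card = (G.neighborSet v).ncard + 1 := by
  classical
  rw [← Set.ncard_coe_finset, ← Set.ncard_insert_of_notMem (s := G.neighborSet v) (a := v)
    (by simp) (Set.toFinite _)]
  congr 1
  ext u
  simp [closedNeighborFinset]

/-- If no set of at most two vertices, but at least `|V|` sets of three vertices have a
nondominating complement, then every vertex has degree two. -/
theorem isTwoRegular_of_numNonDominating (G : SimpleGraph V) (hn : 3 ≤ Fintype.card V)
    (h1 : numNonDominating G (Fintype.card V - 1) = 0)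
    (h2 : numNonDominating G (Fintype.card V - 2) = 0)
    (h3 : Fintype.card V ≤ numNonDominating G (Fintype.card V - 3)) : IsTwoRegular G := by
  classical
  have hpos : ∀ v, v ∈ closedNeighborFinset G v := fun v => by simp [closedNeighborFinset]
  have hne : ∀ j, j ≤ Fintype.card V → numNonDominating G (Fintype.card V - j) = 0 →
      ∀ v, (closedNeighborFinset G v).card ≠ j := by
    intro j hj h v hv
    rw [numNonDominating_card_sub G hj, Finset.card_eq_zero, Finset.filter_eq_empty_iff] at h
    exact h (Finset.mem_powersetCard_univ.2 hv) ⟨v, subset_rfl⟩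
  have hge : ∀ v, 3 ≤ (closedNeighborFinset G v).card := fun v => by
    have := Finset.card_pos.2 ⟨v, hpos v⟩
    have := hne 1 (by omega) h1 v
    have := hne 2 (by omega) h2 v
    omega
  have hsub : (Finset.powersetCard 3 Finset.univ).filter
      (fun T => ∃ v, closedNeighborFinset G v ⊆ T) ⊆
      (Finset.univ.filter fun v => (closedNeighborFinset G v).card = 3).image
        (closedNeighborFinset G) := by
    intro T hT
    obtain ⟨hT, v, hv⟩ := Finset.mem_filter.1 hT
    rw [Finset.mem_powersetCard_univ] at hT
    have h := Finset.eq_of_subset_of_card_le hv (hT ▸ hge v)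
    exact Finset.mem_image.2 ⟨v, Finset.mem_filter.2 ⟨Finset.mem_univ v, h ▸ hT⟩, h⟩
  -- at least `|V|` such sets arise from the vertices with a closed neighbourhood of size three,
  -- so these are all vertices
  have hcard : (Finset.univ.filter fun v => (closedNeighborFinset G v).card = 3) =
      Finset.univ := by
    refine Finset.eq_univ_of_card _ (le_antisymm (Finset.card_le_univ _) ?_)
    rw [numNonDominating_card_sub G hn] at h3
    exact h3.trans ((Finset.card_le_card hsub).trans Finset.card_image_le)
  intro v
  have h := (Finset.mem_filter.1 (hcard ▸ Finset.mem_univ v)).2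
  rw [card_closedNeighborFinset] at h
  omega

end Counting

/-! ### Cycles are determined by their domination counts -/

section Cycle

theorem mem_closedNeighborFinset_cycleGraph {k : ℕ} (v u : Fin (k + 1)) :
    u ∈ closedNeighborFinset (SimpleGraph.cycleGraph (k + 1)) v ↔
      u = v ∨ u = v - 1 ∨ u = v + 1 := by
  simp only [closedNeighborFinset, Finset.mem_filter, Finset.mem_univ, true_and]
  rw [SimpleGraph.adj_comm, cycleGraph_adj_iff]
  tauto

theorem card_closedNeighborFinset_cycleGraph {k : ℕ} (v : Fin (k + 4)) :
    (closedNeighborFinset (SimpleGraph.cycleGraph (k + 4)) v).card = 3 := by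
  have h : closedNeighborFinset (SimpleGraph.cycleGraph (k + 4)) v = {v, v - 1, v + 1} := by
    ext u
    rw [mem_closedNeighborFinset_cycleGraph]
    simp
  have h2 : (1 : Fin (k + 4)) + 1 ≠ 0 := by
    intro h
    have h3 := congrArg Fin.val h
    have h4 : 2 % (k + 4) = 0 := by simpa [Fin.val_add] using h3
    rw [Nat.mod_eq_of_lt (by omega)] at h4
    omega
  rw [h, Finset.card_eq_three]
  refine ⟨_, _, _, ?_, ?_, ?_, rfl⟩
  · simp [eq_sub_iff_add_eq]
  · simp
  · rw [Ne, sub_eq_iff_eq_add, add_assoc, left_eq_add]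
    exact h2

open Fin.CommRing in
theorem closedNeighborFinset_cycleGraph_injective (k : ℕ) :
    Function.Injective (closedNeighborFinset (SimpleGraph.cycleGraph (k + 4))) := by
  have hne : ∀ a : ℕ, 0 < a → a < 4 → (Nat.cast a : Fin (k + 4)) ≠ 0 := by
    intro a ha ha' h
    have h3 := congrArg Fin.val h
    rw [Fin.val_natCast, Nat.mod_eq_of_lt (by omega)] at h3
    simp at h3
    omega
  have h1 := hne 1 (by norm_num) (by norm_num)
  have h2 := hne 2 (by norm_num) (by norm_num)
  have h3 := hne 3 (by norm_num) (by norm_num)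
  push_cast at h1 h2 h3
  -- two consecutive vertices `v`, `v + 1` have different closed neighbourhoods
  have key : ∀ v, closedNeighborFinset (SimpleGraph.cycleGraph (k + 4)) v ≠
      closedNeighborFinset (SimpleGraph.cycleGraph (k + 4)) (v + 1) := by
    intro v h
    have hm : v + 1 + 1 ∈ closedNeighborFinset (SimpleGraph.cycleGraph (k + 4)) v := by
      rw [h, mem_closedNeighborFinset_cycleGraph]; simp
    rw [mem_closedNeighborFinset_cycleGraph] at hm
    rcases hm with hm | hm | hm
    · exact h2 (by linear_combination hm)
    · exact h3 (by linear_combination hm)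
    · exact h1 (by linear_combination hm)
  intro v w h
  have hm : v ∈ closedNeighborFinset (SimpleGraph.cycleGraph (k + 4)) w := by
    rw [← h, mem_closedNeighborFinset_cycleGraph]; simp
  rw [mem_closedNeighborFinset_cycleGraph] at hm
  rcases hm with rfl | rfl | rfl
  · rfl
  · exact absurd h (by simpa using key (w - 1))
  · exact absurd h.symm (key w)

theorem nonempty_iso_cycleGraph_of_numNonDominating_eq {V : Type*} [Fintype V] {n : ℕ}
    (hn : 4 ≤ n) (G : SimpleGraph V) (hc : Fintype.card V = n)
    (h : ∀ i, numNonDominating G i = numNonDominating (SimpleGraph.cycleGraph n) i) :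
    Nonempty (G ≃g SimpleGraph.cycleGraph n) := by
  classical
  obtain ⟨k, rfl⟩ := Nat.exists_eq_add_of_le' hn
  have hcF : Fintype.card (Fin (k + 4)) = k + 4 := Fintype.card_fin _
  have hsmall : ∀ j, j < 3 →
      numNonDominating (SimpleGraph.cycleGraph (k + 4)) (k + 4 - j) = 0 := by
    intro j hj
    have := numNonDominating_card_sub_eq_zero (G := SimpleGraph.cycleGraph (k + 4)) (j := j)
      (by omega) fun v => by rwa [card_closedNeighborFinset_cycleGraph]
    rwa [hcF] at this
  have hthree : k + 4 ≤ numNonDominating (SimpleGraph.cycleGraph (k + 4)) (k + 4 - 3) := by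
    have := card_le_numNonDominating_card_sub (by omega) card_closedNeighborFinset_cycleGraph
      (closedNeighborFinset_cycleGraph_injective k)
    rwa [hcF] at this
  have hG : IsTwoRegular G := by
    refine isTwoRegular_of_numNonDominating G (by omega) ?_ ?_ ?_
    · rw [h, hc]; exact hsmall 1 (by norm_num)
    · rw [h, hc]; exact hsmall 2 (by norm_num)
    · rw [h, hc]; exact hthree
  have : Nonempty V := Fintype.card_pos_iff.1 (by omega)
  rcases hG.iso_cycleGraph_or_omitPoly_eq_prod (X : ℤ[X]) _ hc with e | ⟨M, h0, h1, h2, h3⟩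
  · exact e
  · refine absurd ?_ (prod_cycleTerm_ne (by omega) M h0 h1 h2)
    have hd : ∀ i, numDominating G i = numDominating (SimpleGraph.cycleGraph (k + 4)) i := by
      intro i
      have e1 := numDominating_add_numNonDominating G i
      have e2 := numDominating_add_numNonDominating (SimpleGraph.cycleGraph (k + 4)) i
      rw [hcF] at e2
      rw [hc, h] at e1
      omega
    rw [← h3, ← omitPoly_cycleGraph X (by omega), omitPoly_eq_sum_numDominating,
      omitPoly_eq_sum_numDominating, hc, hcF]
    simp only [hd]

end Cycle

/-! ### Joins with complete graphs -/

section Join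

variable {V V' W W' : Type*}

/-- The join of isomorphic graphs. -/
def joinCongr {G : SimpleGraph V} {G' : SimpleGraph V'} {H : SimpleGraph W} {H' : SimpleGraph W'}
    (e : G ≃g G') (f : H ≃g H') : join G H ≃g join G' H' where
  toEquiv := Equiv.sumCongr e.toEquiv f.toEquiv
  map_rel_iff' := by
    rintro (a | a) (b | b)
    · simpa [join] using e.map_adj_iff
    · simp [join]
    · simp [join]
    · simpa [join] using f.map_adj_iff

/-- A graph is the join of the complete graph on its universal vertices with the rest. -/
theorem nonempty_iso_join_top (G : SimpleGraph V) :
    Nonempty (join (⊤ : SimpleGraph {v | ∀ w, w ≠ v → G.Adj v w})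
      (G.induce {v | ∀ w, w ≠ v → G.Adj v w}ᶜ) ≃g G) := by
  classical
  refine ⟨⟨Equiv.Set.sumCompl _, ?_⟩⟩
  rintro (⟨a, ha⟩ | ⟨a, ha⟩) (⟨b, hb⟩ | ⟨b, hb⟩)
  · have : G.Adj a b ↔ a ≠ b := ⟨fun h => h.ne, fun h => ha b h.symm⟩
    simp [join, this]
  · have : G.Adj a b := ha b (by rintro rfl; exact hb ha)
    simp [join, this]
  · have : G.Adj a b := (hb a (by rintro rfl; exact ha hb)).symm
    simp [join, this]
  · simp [join]

theorem join_top_top : join (⊤ : SimpleGraph V) (⊤ : SimpleGraph W) = ⊤ := by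
  ext (a | a) (b | b) <;> simp [join]

theorem cycleGraph_eq_top_of_lt_four {n : ℕ} (hn : n < 4) : SimpleGraph.cycleGraph n = ⊤ := by
  interval_cases n
  · exact Subsingleton.elim _ _
  · exact Subsingleton.elim _ _
  · exact SimpleGraph.cycleGraph_two_eq_top
  · exact SimpleGraph.cycleGraph_three_eq_top

theorem dUnique_join_completeGraph_cycleGraph (m n : ℕ) (hn : 0 < n) :
    DUnique.{w} (join (SimpleGraph.completeGraph (Fin m)) (SimpleGraph.cycleGraph n)) := by
  classical
  intro W _ H hH
  change DEquivalent H (join (⊤ : SimpleGraph (Fin m)) _) at hH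
  change Nonempty (H ≃g join (⊤ : SimpleGraph (Fin m)) _)
  have : Nonempty (Fin n) := ⟨⟨0, hn⟩⟩
  have hcard := hH.card_eq
  have hnum := hH.numNonDominating_eq
  rcases lt_or_ge n 4 with hn4 | hn4
  · rw [cycleGraph_eq_top_of_lt_four hn4, join_top_top] at hnum ⊢
    have h1 := hnum 1
    rw [(numNonDominating_one_eq_zero_iff _).2 rfl, numNonDominating_one_eq_zero_iff] at h1
    rw [h1]
    exact ⟨SimpleGraph.Iso.completeGraph (Fintype.equivOfCardEq hcard)⟩
  · simp only [numNonDominating_join_top] at hnum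
    rw [Fintype.card_sum, Fintype.card_fin, Fintype.card_fin] at hcard
    -- no vertex of a cycle of length at least four dominates on its own
    have hone : numNonDominating (SimpleGraph.cycleGraph n) 1 = n := by
      obtain ⟨k, rfl⟩ := Nat.exists_eq_add_of_le' hn4
      rw [numNonDominating_one, Finset.filter_true_of_mem, Finset.card_univ, Fintype.card_fin]
      intro v _ hv
      rw [isDominating_singleton_iff] at hv
      have h3 := card_closedNeighborFinset_cycleGraph v
      rw [Finset.eq_univ_of_forall (s := closedNeighborFinset _ v) (fun u => by
        simpa [closedNeighborFinset] using or_iff_not_imp_left.2 (hv u)), Finset.card_univ,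
        Fintype.card_fin] at h3
      omega
    let U : Set W := {v | ∀ w, w ≠ v → H.Adj v w}
    obtain ⟨e⟩ := nonempty_iso_join_top H
    change join (⊤ : SimpleGraph U) (H.induce Uᶜ) ≃g H at e
    have hcU' : Fintype.card (Uᶜ : Set W) = n := by
      rw [← hone, ← hnum, numNonDominating_one, ← Set.toFinset_card]
      congr 1
      ext v
      simp [U, isDominating_singleton_iff]
    have hcU : Fintype.card U = m := by
      have h := Fintype.card_congr e.toEquiv
      rw [Fintype.card_sum] at h
      omega
    have : Nonempty (Uᶜ : Set W) := Fintype.card_pos_iff.1 (by omega)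
    obtain ⟨f⟩ := nonempty_iso_cycleGraph_of_numNonDominating_eq hn4 (H.induce Uᶜ) hcU' fun i => by
      rw [← hnum, ← numNonDominating_congr e, numNonDominating_join_top]
    have g : (⊤ : SimpleGraph U) ≃g (⊤ : SimpleGraph (Fin m)) :=
      SimpleGraph.Iso.completeGraph (Fintype.equivFinOfCardEq hcU)
    exact ⟨e.symm.trans (joinCongr g f)⟩

end Join

end DomPoly

theorem mainTheorem2 :
    (∀ m n : ℕ, 0 < m → 0 < n →
      DomPoly.DUnique.{w}
        (DomPoly.join (SimpleGraph.completeGraph (Fin m)) (SimpleGraph.cycleGraph n))) ∧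
    (∀ n : ℕ, 2 ≤ n → DomPoly.DUnique.{w} (DomPoly.wheel n)) :=
  ⟨fun m n _ hn => DomPoly.dUnique_join_completeGraph_cycleGraph m n hn,
    fun n hn => DomPoly.dUnique_join_completeGraph_cycleGraph 1 (n - 1) (by omega)⟩
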